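/- Let $N,d\ge 1$ be integers, let $\lambda,\mu,\xi>0$, and let $C=(c_{l,j})_{1\le l,j\le d}$ be an irreducible (row-)stochastic matrix. Consider the continuous-time Markov chain $(\mathcal N(t),J(t))_{t\ge 0}$ on $\{0,\dots,N\}\times\{1,\dots,d\}$ (level, phase), started in $(0,l_0)$ for some $l_0\in\{1,\dots,d\}$, whose transitions are the following: - from $(0,l)$ to $(1,j)$ at rate $\lambda N c_{l,j}$; - from $(k,j)$ to $(k+1,j)$ at rate $\lambda(N-k)$, for $1\le k\le N-1$; - from $(k,j)$ to $(k-1,j)$ at rate $\mu(N+k)$, for $1\le k\le N$; - in addition, from $(k,j)$ to $(0,j)$ at rate $\xi$ (a catastrophe), for $1\le k\le N$ (so that for $k=1$ the total rate to $(0,j)$ is $\mu(N+1)+\xi$). Write $(a)_n=a(a+1)\cdots(a+n-1)$ and ${}_3F_2(\{a_1,a_2,a_3\},\{b_1,b_2\},z)=\sum_{n\ge 0}\frac{(a_1)_n(a_2)_n(a_3)_n}{(b_1)_n(b_2)_n}\frac{z^n}{n!}$. Assume $\lambda=\mu$. Then for every $k\in\{0,\dots,N\}$ the limit $\rho(k)=\lim_{t\to+\infty}\mathbb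 P(\mathcal N(t)=k)$ exists, does not depend on $l_0$, and is the probability of level $k$ under every stationary distribution of the chain. It is given by $$\rho(0)=\frac{2}{1+\dfrac{\left(1+\frac{\xi}{4\lambda}\right)_N}{\left(\frac14\left(2+\frac{\xi}{\lambda}\right)\right)_N}}$$ and, for $r=1,\dots,N$, by $$\rho(r)=\left(\tfrac14\right)^N\binom{2N}{N-r}\,r!\,\frac{\Gamma\left(1+\frac{\xi}{4\lambda}\right)\Gamma\left(\frac12+\frac{\xi}{4\lambda}\right)}{\Gamma\left(1+N+\frac{\xi}{4\lambda}\right)\Gamma\left(\frac12+\frac{\xi}{4\lambda}\right)+\Gamma\left(1+\frac{\xi}{4\lambda}\right)\Gamma\left(N+\frac12+\frac{\xi}{4\lambda}\right)}\,\bigl(A_r+B_r\bigr),$$ where $$A_r={}_3F_2\left(\left\{r-N,\tfrac12+r,\tfrac{\xi}{4\lambda}\right\},\left\{\tfrac12-N,r+1+\tfrac{\xi}{4\lambda}\right\},1\right)\frac{\Gamma\left(1+N+\frac{\xi}{4\lambda}\right)}{\Gamma\left(1+r+\frac{\xi}{4\lambda}\right)},$$ $$B_r={}_3F_2\left(\left\{r-N,\tfrac12+r,\tfrac{\xi}{4\lambda}+\tfrac12\right\},\left\{\tfrac12-N,r+\tfrac12+\tfrac{\xi}{4\lambda}\right\},1\right)\frac{\Gamma\left(\frac12+N+\frac{\xi}{4\lambda}\right)}{\Gamma\left(\frac12+r+\frac{\xi}{4\lambda}\right)}.$$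 -/

import Mathlib

open Filter Topology
open scoped Nat

namespace Ehrenfest

/-- Rate at which the level jumps from `k` to `k'` with the phase unchanged, for the motion that
starts in a non-empty system (`k ≠ 0`): births, deaths and catastrophes. If `k = 1` and `k' = 0`
the death rate and the catastrophe rate add up. -/
noncomputable def samePhaseRate (N : ℕ) (lam mu xi : ℝ) (k k' : Fin (N + 1)) : ℝ :=
  (if (k : ℕ) ≠ 0 ∧ (k' : ℕ) = k + 1 then lam * ((N : ℝ) - (k : ℕ)) else 0) +
  (if (k : ℕ) = k' + 1 then mu * ((N : ℝ) + (k : ℕ)) else 0) +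
  (if (k : ℕ) ≠ 0 ∧ (k' : ℕ) = 0 then xi else 0)

/-- Off-diagonal transition rates of the multi-type Ehrenfest process with catastrophes.
States are pairs (level, phase). From `(0, l)` the process moves to `(1, j)` at rate
`lam * N * C l j`; from a positive level it moves without changing its phase. -/
noncomputable def rate (N : ℕ) {d : ℕ} (lam mu xi : ℝ) (C : Matrix (Fin d) (Fin d) ℝ)
    (s s' : Fin (N + 1) × Fin d) : ℝ :=
  (if (s.1 : ℕ) = 0 ∧ (s'.1 : ℕ) = 1 then lam * N * C s.2 s'.2 else 0) +
  (if s.2 = s'.2 then samePhaseRate N lam mu xi s.1 s'.1 else 0)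

/-- The infinitesimal generator: the rates off the diagonal, and minus the total exit rate on it. -/
noncomputable def generator (N : ℕ) {d : ℕ} (lam mu xi : ℝ) (C : Matrix (Fin d) (Fin d) ℝ) :
    Matrix (Fin (N + 1) × Fin d) (Fin (N + 1) × Fin d) ℝ :=
  Matrix.of (rate N lam mu xi C) - Matrix.diagonal fun s => ∑ s', rate N lam mu xi C s s'

/-- State probability `p(k, j, t)`: the probability that the continuous-time Markov chain with
the above generator, started in `(0, l₀)`, is in the state `(k, j)` at time `t`. -/
noncomputable def stateProb (N : ℕ) {d : ℕ} (lam mu xi : ℝ) (C : Matrix (Fin d) (Fin d) ℝ)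
    (l₀ : Fin d) (k : Fin (N + 1)) (j : Fin d) (t : ℝ) : ℝ :=
  NormedSpace.exp (t • generator N lam mu xi C) (0, l₀) (k, j)

/-- Marginal probability `p(k, t)` that the level is `k` at time `t`. -/
noncomputable def levelProb (N : ℕ) {d : ℕ} (lam mu xi : ℝ) (C : Matrix (Fin d) (Fin d) ℝ)
    (l₀ : Fin d) (k : Fin (N + 1)) (t : ℝ) : ℝ :=
  ∑ j, stateProb N lam mu xi C l₀ k j t

/-- `π` is a stationary distribution of the chain. -/
def IsStationary (N : ℕ) {d : ℕ} (lam mu xi : ℝ) (C : Matrix (Fin d) (Fin d) ℝ)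
    (π : Fin (N + 1) × Fin d → ℝ) : Prop :=
  (∀ s, 0 ≤ π s) ∧ ∑ s, π s = 1 ∧ Matrix.vecMul π (generator N lam mu xi C) = 0

/-- The Pochhammer symbol `(a)_n = a (a + 1) ⋯ (a + n - 1)`. -/
noncomputable def poch (a : ℝ) (n : ℕ) : ℝ := (ascPochhammer ℝ n).eval a

/-- The generalized hypergeometric series `₃F₂({a₁, a₂, a₃}, {b₁, b₂}; z)`. -/
noncomputable def hyp32 (a₁ a₂ a₃ b₁ b₂ z : ℝ) : ℝ :=
  ∑' n : ℕ, poch a₁ n * poch a₂ n * poch a₃ n / (poch b₁ n * poch b₂ n) * (z ^ n / n !)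

end Ehrenfest

/-! Since the rows of `C` sum to 1, forgetting the phase leaves a Markov chain on the levels
(`generator_mul_levelProjection`), in which catastrophes are resets to 0 at constant rate ξ
(`generatorOf_levelRate_eq`). On vectors of total mass 0 such resets multiply the semigroup by
e^(-ξt) (`vecMul_exp_reset`). Hence a normalized solution of the level balance equations is at once
the limit and the level marginal of every stationary law (`limit_and_marginal_of_balance`). It
remains to exhibit a solution.

For λ = μ, compare with the Ehrenfest process on {-N, …, N}: 2N independent spins, each flipping at
rate λ. In u = e^(-4λt), its probability of r ≥ 0 at time t, starting from 0, is a constant times (1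
- u)^r times a Gegenbauer polynomial of parameter r + 1/2 (`ehrenfestPoly`). With resets at rate ξ =
4λx, its stationary law q is the law at an independent exponential time, so q_r is the integral of x
u^(x-1) against that polynomial over [0, 1]. The level chain has the same rates at positive levels,
and its balance equation at 0 is half the two-sided one combined with normalization; so ρ(r) = 2 q_r
/ (1 + q_0).

Integrating term by term gives the first ₃F₂. For the second, divide the polynomial by 1 - u: the
result at (N, x + 1/2) satisfies the same recurrence in r as q at (N + 1, x), hence is proportional
to it (`poch_mul_twoSidedProb`). The same link gives q_0 as a ratio of Pochhammer symbols by
induction on N (`poch_mul_twoSidedProb_zero`). Thus A_r = B_r, and the stated sum is a symmetric way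
to write 2 q_r / (1 + q_0). -/

namespace Ehrenfest

/-! ### Matrix semigroups and the decay caused by resets. -/

section Exponential

open scoped Matrix.Norms.Operator

/-- Powers intertwine, hence so do the exponential series. Different choices of `W` give the
lumping, the decay under resets and the invariance of stationary vectors. -/
theorem exp_mul_of_intertwines {m n : Type*} [Fintype m] [DecidableEq m] [Fintype n]
    [DecidableEq n] (A : Matrix m m ℝ) (B : Matrix n n ℝ) (W : Matrix m n ℝ)
    (h : A * W = W * B) : NormedSpace.exp A * W = W * NormedSpace.exp B := by
  have hp : ∀ k : ℕ, A ^ k * W = W * B ^ k := by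
    intro k
    induction k with
    | zero => simp
    | succ k ih => rw [pow_succ, pow_succ, Matrix.mul_assoc, h, ← Matrix.mul_assoc, ih,
        Matrix.mul_assoc]
  have h1 := (NormedSpace.exp_series_hasSum_exp' (𝕂 := ℝ) A).map
    (Matrix.addMonoidHomMulRight W) (by
      change Continuous fun M : Matrix m m ℝ => M * W
      fun_prop)
  have h2 := (NormedSpace.exp_series_hasSum_exp' (𝕂 := ℝ) B).map
    (Matrix.addMonoidHomMulLeft W) (by
      change Continuous fun M : Matrix n n ℝ => W * M
      fun_prop)
  refine h1.unique (h2.congr_fun ?_)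
  intro k
  simp [Matrix.addMonoidHomMulRight, Matrix.addMonoidHomMulLeft, hp]

theorem norm_exp_le_exp_norm {n : Type*} [Fintype n] [DecidableEq n] [Nonempty n]
    (A : Matrix n n ℝ) : ‖NormedSpace.exp A‖ ≤ Real.exp ‖A‖ := by
  have h1 := NormedSpace.exp_series_hasSum_exp' (𝕂 := ℝ) A
  have h2 := NormedSpace.exp_series_hasSum_exp' (𝕂 := ℝ) ‖A‖
  rw [← Real.exp_eq_exp_ℝ] at h2
  refine h1.norm_le_of_bounded h2 fun k => ?_
  rw [norm_smul, smul_eq_mul, Real.norm_of_nonneg (by positivity)]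
  gcongr
  exact norm_pow_le _ _

theorem exp_add_smul_one {n : Type*} [Fintype n] [DecidableEq n] (A : Matrix n n ℝ) (c : ℝ) :
    NormedSpace.exp (A + c • (1 : Matrix n n ℝ)) = Real.exp c • NormedSpace.exp A := by
  have h : NormedSpace.exp (c • (1 : Matrix n n ℝ)) = Real.exp c • (1 : Matrix n n ℝ) := by
    rw [Matrix.smul_one_eq_diagonal, Matrix.smul_one_eq_diagonal]
    refine (Matrix.exp_diagonal _).trans (congrArg _ ?_)
    ext i
    rw [Real.exp_eq_exp_ℝ]
    exact congrFun (Pi.exp_def (𝔸 := fun _ : n => ℝ) _) i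
  refine (Matrix.exp_add_of_commute A (c • 1) ((Commute.one_right A).smul_right c)).trans ?_
  rw [h, mul_smul_comm, mul_one]

/-- The infinitesimal generator with the given transition rates. -/
noncomputable def generatorOf {n : Type*} [Fintype n] [DecidableEq n] (R : Matrix n n ℝ) :
    Matrix n n ℝ :=
  R - Matrix.diagonal fun i => ∑ j, R i j

theorem sum_generatorOf {n : Type*} [Fintype n] [DecidableEq n] (R : Matrix n n ℝ) (i : n) :
    ∑ j, generatorOf R i j = 0 := by
  simp [generatorOf, Matrix.diagonal_apply, Finset.sum_sub_distrib]

/-- Uniformization: adding `c • 1` with `c` large makes the generator a nonnegative matrix with row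
sums `c`, so of norm at most `c`. The scalar factor e^(-tc) then compensates. -/
theorem norm_exp_generatorOf_le_one {n : Type*} [Fintype n] [DecidableEq n] [Nonempty n]
    (R : Matrix n n ℝ) (hR : ∀ i j, 0 ≤ R i j) {t : ℝ} (ht : 0 ≤ t) :
    ‖NormedSpace.exp (t • generatorOf R)‖ ≤ 1 := by
  set c : ℝ := ∑ i, ∑ j, R i j with hc
  have hc0 : 0 ≤ c := Finset.sum_nonneg fun i _ => Finset.sum_nonneg fun j _ => hR i j
  have hrow : ∀ i, ∑ j, R i j ≤ c := fun i =>
    Finset.single_le_sum (f := fun i => ∑ j, R i j)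
      (fun i _ => Finset.sum_nonneg fun j _ => hR i j) (Finset.mem_univ i)
  set P : Matrix n n ℝ := generatorOf R + c • (1 : Matrix n n ℝ) with hP
  have hPnn : ∀ i j, 0 ≤ P i j := by
    intro i j
    by_cases hij : i = j
    · subst hij
      simp only [hP, generatorOf, Matrix.add_apply, Matrix.sub_apply, Matrix.diagonal_apply_eq,
        Matrix.smul_apply, Matrix.one_apply_eq, smul_eq_mul, mul_one]
      linarith [hrow i, hR i i]
    · simp [hP, generatorOf, hij, hR i j]
  have hPsum : ∀ i, ∑ j, P i j = c := by
    intro i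
    simp [hP, Finset.sum_add_distrib, sum_generatorOf, Matrix.one_apply]
  have hPnorm : ‖P‖ ≤ c := by
    rw [Matrix.linfty_opNorm_def, ← NNReal.coe_mk c hc0, NNReal.coe_le_coe]
    refine Finset.sup_le fun i _ => ?_
    rw [← NNReal.coe_le_coe, NNReal.coe_sum, NNReal.coe_mk, ← hPsum i]
    refine Finset.sum_le_sum fun j _ => ?_
    rw [coe_nnnorm, Real.norm_of_nonneg (hPnn i j)]
  have hsplit : t • generatorOf R = t • P + (-(t * c)) • (1 : Matrix n n ℝ) := by
    rw [hP]
    module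
  have hexp : NormedSpace.exp (t • generatorOf R) =
      Real.exp (-(t * c)) • NormedSpace.exp (t • P) := by
    rw [hsplit, exp_add_smul_one]
  refine (congrArg norm hexp).trans_le ?_
  rw [norm_smul, Real.norm_of_nonneg (Real.exp_pos _).le, mul_comm]
  calc ‖NormedSpace.exp (t • P)‖ * Real.exp (-(t * c))
      ≤ Real.exp (t * c) * Real.exp (-(t * c)) := by
        gcongr
        refine (norm_exp_le_exp_norm _).trans (Real.exp_le_exp.2 ?_)
        rw [norm_smul, Real.norm_of_nonneg ht]
        gcongr
    _ = 1 := by rw [← Real.exp_add]; simp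

/-- The transition matrix that moves every state to `o`. -/
def resetMatrix {n : Type*} [DecidableEq n] (o : n) : Matrix n n ℝ :=
  Matrix.of fun _ j => if j = o then 1 else 0

theorem mul_resetMatrix {n : Type*} [Fintype n] [DecidableEq n] (o : n) (A : Matrix n n ℝ)
    (c : ℝ) (hA : ∀ i, ∑ j, A i j = c) : A * resetMatrix o = c • resetMatrix o := by
  ext i j
  simp [Matrix.mul_apply, resetMatrix, hA]

theorem vecMul_exp_reset {n : Type*} [Fintype n] [DecidableEq n] (o : n) (R : Matrix n n ℝ)
    (xi t : ℝ) (v : n → ℝ) (hv : ∑ i, v i = 0) :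
    Matrix.vecMul v (NormedSpace.exp (t • (generatorOf R + xi • (resetMatrix o - 1)))) =
      Real.exp (-(t * xi)) • Matrix.vecMul v (NormedSpace.exp (t • generatorOf R)) := by
  set U := resetMatrix o with hU
  set G := generatorOf R with hG
  set Q := G + xi • (U - 1) with hQ
  have hUU : U * U = U := by
    rw [hU, mul_resetMatrix o _ 1 (by simp [resetMatrix]), one_smul]
  have hGU : G * U = 0 := by
    rw [hU, mul_resetMatrix o _ 0 (sum_generatorOf R), zero_smul]
  have hQU : Q * U = 0 := by
    rw [hQ, add_mul, hGU, smul_mul_assoc, sub_mul, hUU, one_mul, sub_self, smul_zero, add_zero]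
  have hMU : (1 - U) * U = 0 := by rw [sub_mul, hUU, one_mul, sub_self]
  have hMQ : (1 - U) * (G - xi • 1) = (1 - U) * Q := by
    rw [hQ, mul_sub, mul_add, mul_smul_comm, mul_smul_comm, mul_sub, hMU]
    simp only [mul_one]
    module
  -- Because `Q * U = 0`, the single matrix `t • ((1 - U) * Q)` is intertwined by `1 - U` both with
  -- `t • Q` and with `t • (G - xi • 1)`. The two exponentials therefore agree after multiplication
  -- by `1 - U`, which fixes row vectors of mass 0.
  have e1 : (t • ((1 - U) * Q)) * (1 - U) = (1 - U) * (t • Q) := by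
    rw [mul_smul_comm, smul_mul_assoc, mul_assoc, mul_sub, hQU, sub_zero, mul_one]
  have e2 : (t • ((1 - U) * Q)) * (1 - U) = (1 - U) * (t • (G - xi • 1)) := by
    rw [e1, mul_smul_comm, mul_smul_comm, hMQ]
  have key : (1 - U) * NormedSpace.exp (t • Q) = (1 - U) * NormedSpace.exp (t • (G - xi • 1)) :=
    (exp_mul_of_intertwines _ _ _ e1).symm.trans (exp_mul_of_intertwines _ _ _ e2)
  have hexp : NormedSpace.exp (t • (G - xi • (1 : Matrix n n ℝ))) =
      Real.exp (-(t * xi)) • NormedSpace.exp (t • G) := by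
    have hsplit : t • (G - xi • (1 : Matrix n n ℝ)) =
        t • G + (-(t * xi)) • (1 : Matrix n n ℝ) := by
      module
    rw [hsplit, exp_add_smul_one]
  have hvM : Matrix.vecMul v (1 - U) = v := by
    ext j
    simp [Matrix.vecMul, dotProduct, hU, resetMatrix, mul_sub, Finset.sum_sub_distrib,
      hv, Matrix.one_apply]
  calc Matrix.vecMul v (NormedSpace.exp (t • Q))
      = Matrix.vecMul (Matrix.vecMul v (1 - U)) (NormedSpace.exp (t • Q)) := by rw [hvM]
    _ = Matrix.vecMul (Matrix.vecMul v (1 - U)) (NormedSpace.exp (t • (G - xi • 1))) := by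
        rw [Matrix.vecMul_vecMul, key, Matrix.vecMul_vecMul]
    _ = _ := by rw [hvM, hexp, Matrix.vecMul_smul]

theorem tendsto_vecMul_exp_reset {n : Type*} [Fintype n] [DecidableEq n] (o : n)
    (R : Matrix n n ℝ) (hR : ∀ i j, 0 ≤ R i j) {xi : ℝ} (hxi : 0 < xi) (v : n → ℝ)
    (hv : ∑ i, v i = 0) (k : n) :
    Tendsto (fun t : ℝ => Matrix.vecMul v
      (NormedSpace.exp (t • (generatorOf R + xi • (resetMatrix o - 1)))) k) atTop (𝓝 0) := by
  have : Nonempty n := ⟨o⟩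
  have hentry : ∀ (A : Matrix n n ℝ) (i j : n), |A i j| ≤ ‖A‖ := by
    intro A i j
    rw [Matrix.linfty_opNorm_def, ← Real.norm_eq_abs, ← coe_nnnorm, NNReal.coe_le_coe]
    exact (Finset.single_le_sum (f := fun j => ‖A i j‖₊) (fun _ _ => zero_le)
      (Finset.mem_univ j)).trans (Finset.le_sup (f := fun i => ∑ j, ‖A i j‖₊) (Finset.mem_univ i))
  have hlim : Tendsto (fun t : ℝ => Real.exp (-(t * xi)) * ∑ i, |v i|) atTop (𝓝 0) := by
    have h : Tendsto (fun t : ℝ => Real.exp (-(t * xi))) atTop (𝓝 0) :=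
      Real.tendsto_exp_neg_atTop_nhds_zero.comp (tendsto_id.atTop_mul_const hxi)
    simpa using h.mul_const (∑ i, |v i|)
  refine squeeze_zero_norm' ?_ hlim
  filter_upwards [eventually_ge_atTop (0 : ℝ)] with t ht
  rw [vecMul_exp_reset o R xi t v hv, Pi.smul_apply, smul_eq_mul, norm_mul,
    Real.norm_of_nonneg (Real.exp_pos _).le]
  gcongr
  rw [Matrix.vecMul, dotProduct]
  refine (norm_sum_le _ _).trans (Finset.sum_le_sum fun i _ => ?_)
  rw [norm_mul, Real.norm_eq_abs]
  exact mul_le_of_le_one_right (abs_nonneg _)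
    ((hentry _ _ _).trans (norm_exp_generatorOf_le_one R hR ht))

theorem vecMul_exp_of_stationary {n : Type*} [Fintype n] [DecidableEq n] (Q : Matrix n n ℝ)
    (v : n → ℝ) (hv : Matrix.vecMul v Q = 0) (t : ℝ) :
    Matrix.vecMul v (NormedSpace.exp (t • Q)) = v := by
  have h := exp_mul_of_intertwines (0 : Matrix Unit Unit ℝ) (t • Q) (Matrix.replicateRow Unit v) (by
    rw [Matrix.zero_mul, Matrix.mul_smul, ← Matrix.replicateRow_vecMul, hv]
    ext
    simp)
  rw [NormedSpace.exp_zero, Matrix.one_mul, ← Matrix.replicateRow_vecMul] at h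
  exact (Matrix.replicateRow_injective h).symm

end Exponential

/-! ### Lumping the chain to its levels. -/

/-- Transition rates of the level. -/
noncomputable def levelRate (N : ℕ) (lam mu xi : ℝ) : Matrix (Fin (N + 1)) (Fin (N + 1)) ℝ :=
  Matrix.of fun k k' =>
    (if (k : ℕ) = 0 ∧ (k' : ℕ) = 1 then lam * N else 0) + samePhaseRate N lam mu xi k k'

/-- The projection of states to levels. -/
def levelProjection (N d : ℕ) : Matrix (Fin (N + 1) × Fin d) (Fin (N + 1)) ℝ :=
  Matrix.of fun s k => if s.1 = k then 1 else 0

/-- At level 0 a reset changes nothing, so catastrophes may be allowed there too; this makes the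
reset rate the same in all states. -/
theorem generatorOf_levelRate_eq (N : ℕ) (lam mu xi : ℝ) :
    generatorOf (levelRate N lam mu xi) =
      generatorOf (levelRate N lam mu 0) + xi • (resetMatrix 0 - 1) := by
  have hdec : ∀ k k' : Fin (N + 1), levelRate N lam mu xi k k' =
      levelRate N lam mu 0 k k' + if k ≠ 0 ∧ k' = 0 then xi else 0 := by
    intro k k'
    simp only [levelRate, samePhaseRate, Matrix.of_apply, Fin.ext_iff, Fin.val_zero, ne_eq]
    split_ifs <;> ring
  ext i j
  simp only [generatorOf, Matrix.sub_apply, Matrix.add_apply, Matrix.smul_apply,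
    Matrix.diagonal_apply, hdec, Finset.sum_add_distrib, resetMatrix, Matrix.of_apply,
    Matrix.one_apply, smul_eq_mul]
  by_cases hi : i = 0 <;> by_cases hj : j = 0 <;> by_cases hij : i = j <;>
    simp_all <;> ring

theorem levelRate_nonneg (N : ℕ) {lam mu xi : ℝ} (hlam : 0 ≤ lam) (hmu : 0 ≤ mu) (hxi : 0 ≤ xi)
    (k k' : Fin (N + 1)) : 0 ≤ levelRate N lam mu xi k k' := by
  have hk : (0 : ℝ) ≤ (N : ℝ) - (k : ℕ) := sub_nonneg.2 (by exact_mod_cast Fin.is_le k)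
  simp only [levelRate, samePhaseRate, Matrix.of_apply]
  split_ifs <;> positivity

theorem generator_mul_levelProjection {N d : ℕ} (lam mu xi : ℝ) (C : Matrix (Fin d) (Fin d) ℝ)
    (hC : C ∈ Matrix.rowStochastic ℝ (Fin d)) :
    generator N lam mu xi C * levelProjection N d =
      levelProjection N d * generatorOf (levelRate N lam mu xi) := by
  have hsum : ∀ s k', ∑ j', rate N lam mu xi C s (k', j') = levelRate N lam mu xi s.1 k' := by
    intro s k'
    simp only [rate, levelRate, Matrix.of_apply, Finset.sum_add_distrib]
    congr 1
    · by_cases h : (s.1 : ℕ) = 0 ∧ (k' : ℕ) = 1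
      · simp only [h, and_self, if_true]
        rw [← Finset.mul_sum, Matrix.sum_row_of_mem_rowStochastic hC, mul_one]
      · simp only [h, if_false, Finset.sum_const_zero]
    · simp
  ext s k'
  have hl : (generator N lam mu xi C * levelProjection N d) s k' =
      ∑ k, ∑ j, (rate N lam mu xi C s (k, j)) * (if k = k' then 1 else 0) -
        (∑ s', rate N lam mu xi C s s') * (if s.1 = k' then 1 else 0) := by
    rw [generator, Matrix.sub_mul, Matrix.sub_apply, Matrix.diagonal_mul, Matrix.mul_apply,
      Fintype.sum_prod_type]
    rfl
  rw [hl, Fintype.sum_prod_type]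
  simp only [← Finset.sum_mul, hsum]
  simp [Matrix.mul_apply, levelProjection, generatorOf, Matrix.diagonal_apply]

theorem levelProb_eq {N d : ℕ} (lam mu xi : ℝ) (C : Matrix (Fin d) (Fin d) ℝ)
    (hC : C ∈ Matrix.rowStochastic ℝ (Fin d)) (l₀ : Fin d) (k : Fin (N + 1)) (t : ℝ) :
    levelProb N lam mu xi C l₀ k t =
      NormedSpace.exp (t • generatorOf (levelRate N lam mu xi)) 0 k := by
  have h := exp_mul_of_intertwines (t • generator N lam mu xi C)
    (t • generatorOf (levelRate N lam mu xi)) (levelProjection N d) (by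
      rw [Matrix.smul_mul, generator_mul_levelProjection lam mu xi C hC, Matrix.mul_smul])
  have h' := congrFun (congrFun h (0, l₀)) k
  rw [Matrix.mul_apply, Matrix.mul_apply, Fintype.sum_prod_type] at h'
  simpa [levelProjection, levelProb, stateProb] using h'

/-- A distribution that solves the balance equations of the level is the limit of the level
probabilities and the level marginal of every stationary distribution. -/
theorem limit_and_marginal_of_balance {N d : ℕ} {lam mu xi : ℝ} (hlam : 0 ≤ lam) (hmu : 0 ≤ mu)
    (hxi : 0 < xi) (C : Matrix (Fin d) (Fin d) ℝ) (hC : C ∈ Matrix.rowStochastic ℝ (Fin d))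
    (ρ : Fin (N + 1) → ℝ) (hsum : ∑ k, ρ k = 1)
    (hbal : Matrix.vecMul ρ (generatorOf (levelRate N lam mu xi)) = 0) :
    (∀ (l₀ : Fin d) (k : Fin (N + 1)), Tendsto (levelProb N lam mu xi C l₀ k) atTop (𝓝 (ρ k))) ∧
    ∀ π : Fin (N + 1) × Fin d → ℝ, IsStationary N lam mu xi C π → ∀ k, ∑ j, π (k, j) = ρ k := by
  have hdecay := fun v hv k => tendsto_vecMul_exp_reset (0 : Fin (N + 1))
    (levelRate N lam mu 0) (levelRate_nonneg N hlam hmu le_rfl) hxi v hv k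
  simp only [← generatorOf_levelRate_eq] at hdecay
  set Q := generatorOf (levelRate N lam mu xi) with hQ
  constructor
  · intro l₀ k
    have h := (hdecay (Pi.single 0 1 - ρ) (by simp [Finset.sum_sub_distrib, hsum]) k).add_const (ρ k)
    rw [zero_add] at h
    refine h.congr fun t => ?_
    rw [levelProb_eq lam mu xi C hC, Matrix.sub_vecMul, vecMul_exp_of_stationary Q ρ hbal,
      Matrix.single_one_vecMul, Pi.sub_apply, sub_add_cancel]
    rfl
  · rintro π ⟨-, hπ, hst⟩ k
    have hmarg : ∀ k, Matrix.vecMul π (levelProjection N d) k = ∑ j, π (k, j) := by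
      intro k
      rw [Matrix.vecMul, dotProduct, Fintype.sum_prod_type, Finset.sum_eq_single k] <;>
        simp +contextual [levelProjection]
    have h0 : Matrix.vecMul (Matrix.vecMul π (levelProjection N d)) Q = 0 := by
      rw [Matrix.vecMul_vecMul, hQ, ← generator_mul_levelProjection lam mu xi C hC,
        ← Matrix.vecMul_vecMul, hst, Matrix.zero_vecMul]
    set w := Matrix.vecMul π (levelProjection N d) - ρ with hw
    have hwQ : Matrix.vecMul w Q = 0 := by rw [hw, Matrix.sub_vecMul, h0, hbal, sub_zero]
    have hws : ∑ k, w k = 0 := by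
      simp only [hw, Pi.sub_apply, Finset.sum_sub_distrib, hmarg, hsum]
      rw [← Fintype.sum_prod_type, hπ, sub_self]
    have h := hdecay w hws k
    simp only [vecMul_exp_of_stationary Q w hwQ] at h
    have := tendsto_nhds_unique tendsto_const_nhds h
    rw [← hmarg]
    simpa [hw, sub_eq_zero] using this

/-! ### Pochhammer symbols and Gegenbauer polynomials. -/

open Polynomial

theorem poch_zero (a : ℝ) : poch a 0 = 1 := by simp [poch]

theorem poch_succ (a : ℝ) (n : ℕ) : poch a (n + 1) = poch a n * (a + n) := by
  simp [poch, ascPochhammer_succ_eval]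

theorem poch_succ_left (a : ℝ) (n : ℕ) : poch a (n + 1) = a * poch (a + 1) n := by
  simp [poch, ascPochhammer_succ_left, eval_comp]

theorem poch_pos {a : ℝ} (ha : 0 < a) (n : ℕ) : 0 < poch a n := ascPochhammer_pos n a ha

/-- The coefficients `(l)_k / k!` of the binomial series `(1 - u)⁻ˡ`. -/
noncomputable def binomCoeff (l : ℝ) (k : ℕ) : ℝ := poch l k / k !

theorem binomCoeff_zero (l : ℝ) : binomCoeff l 0 = 1 := by simp [binomCoeff, poch_zero]

theorem mul_binomCoeff_add_one (l : ℝ) (k : ℕ) :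
    l * binomCoeff (l + 1) k = (l + k) * binomCoeff l k := by
  have h := (poch_succ_left l k).symm.trans (poch_succ l k)
  rw [binomCoeff, binomCoeff, mul_div_assoc', h]
  ring

theorem mul_binomCoeff_succ (l : ℝ) (k : ℕ) :
    (k + 1) * binomCoeff l (k + 1) = l * binomCoeff (l + 1) k := by
  rw [binomCoeff, binomCoeff, poch_succ_left, Nat.factorial_succ]
  push_cast
  field_simp

/-- The Gegenbauer polynomial of degree `n` and parameter `l` as a polynomial in
`u = exp (2 i θ)`, up to the factor `exp (-i n θ)`. -/
noncomputable def gegenbauer (l : ℝ) (n : ℕ) : ℝ[X] :=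
  ∑ k ∈ Finset.range (n + 1), monomial k (binomCoeff l k * binomCoeff l (n - k))

theorem gegenbauer_zero (l : ℝ) : gegenbauer l 0 = 1 := by
  simp [gegenbauer, binomCoeff_zero]

theorem coeff_gegenbauer_add (l : ℝ) (k j : ℕ) :
    (gegenbauer l (k + j)).coeff k = binomCoeff l k * binomCoeff l j := by
  simp [gegenbauer, coeff_monomial]

theorem coeff_gegenbauer_of_lt (l : ℝ) {n k : ℕ} (h : n < k) : (gegenbauer l n).coeff k = 0 := by
  simp only [gegenbauer, finsetSum_coeff, coeff_monomial]
  refine Finset.sum_eq_zero fun i hi => if_neg ?_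
  have := Finset.mem_range.1 hi
  omega

theorem coeff_X_mul_gegenbauer_of_lt (l : ℝ) {n k : ℕ} (h : n + 1 < k) :
    (X * gegenbauer l n).coeff k = 0 := by
  obtain ⟨k, rfl⟩ := Nat.exists_eq_succ_of_ne_zero (by omega : k ≠ 0)
  rw [coeff_X_mul, coeff_gegenbauer_of_lt l (by omega)]

/-- Together with the next two lemmas, this reduces every coefficient of a contiguous polynomial to
a multiple of the same `(gegenbauer l (k + j)).coeff k`. The Gegenbauer identities below then become
polynomial identities in `l`, `k`, `j`; the factor `l ^ 2` clears denominators. -/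
theorem sq_mul_coeff_gegenbauer_add_one (l : ℝ) (k j : ℕ) :
    l ^ 2 * (gegenbauer (l + 1) (k + j)).coeff k =
      (l + k) * (l + j) * (gegenbauer l (k + j)).coeff k := by
  rw [coeff_gegenbauer_add, coeff_gegenbauer_add]
  linear_combination l * binomCoeff (l + 1) j * mul_binomCoeff_add_one l k +
    (l + k) * binomCoeff l k * mul_binomCoeff_add_one l j

theorem sq_mul_coeff_gegenbauer_pred (l : ℝ) {n k j : ℕ} (h : n + 1 = k + j) :
    l ^ 2 * (gegenbauer (l + 1) n).coeff k = (l + k) * j * (gegenbauer l (n + 1)).coeff k := by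
  rw [h, coeff_gegenbauer_add]
  rcases j with _ | j
  · rw [coeff_gegenbauer_of_lt _ (by omega)]
    simp
  · obtain rfl : n = k + j := by omega
    rw [coeff_gegenbauer_add]
    push_cast
    linear_combination l * binomCoeff (l + 1) j * mul_binomCoeff_add_one l k -
      (l + k) * binomCoeff l k * mul_binomCoeff_succ l j

theorem sq_mul_coeff_X_mul_gegenbauer (l : ℝ) {n k j : ℕ} (h : n + 1 = k + j) :
    l ^ 2 * (X * gegenbauer (l + 1) n).coeff k =
      k * (l + j) * (gegenbauer l (n + 1)).coeff k := by
  rw [h, coeff_gegenbauer_add]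
  rcases k with _ | k
  · simp
  · obtain rfl : n = k + j := by omega
    rw [coeff_X_mul, coeff_gegenbauer_add]
    push_cast
    linear_combination l * binomCoeff (l + 1) k * mul_binomCoeff_add_one l j -
      (l + j) * binomCoeff l j * mul_binomCoeff_succ l k

theorem coeff_X_mul_derivative (p : ℝ[X]) (k : ℕ) :
    (X * derivative p).coeff k = k * p.coeff k := by
  rcases k with _ | k
  · simp
  · rw [coeff_X_mul, coeff_derivative]
    push_cast
    ring

theorem coeff_X_mul_X_mul_derivative (p : ℝ[X]) (k : ℕ) :
    (X * (X * derivative p)).coeff k = ((k : ℝ) - 1) * (X * p).coeff k := by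
  rcases k with _ | k
  · simp
  · rw [coeff_X_mul, coeff_X_mul, coeff_X_mul_derivative]
    push_cast
    ring

theorem gegenbauer_derivative {l : ℝ} (hl : l ≠ 0) (n : ℕ) :
    2 * X * derivative (gegenbauer l (n + 1)) =
      ((n : ℝ[X]) + 1) * gegenbauer l (n + 1) - C l * (1 - X) * gegenbauer (l + 1) n := by
  have h1 : 2 * X * derivative (gegenbauer l (n + 1)) =
      C 2 * (X * derivative (gegenbauer l (n + 1))) := by
    simp only [map_ofNat]; ring
  have h2 : ((n : ℝ[X]) + 1) * gegenbauer l (n + 1) - C l * (1 - X) * gegenbauer (l + 1) n =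
      C ((n : ℝ) + 1) * gegenbauer l (n + 1) - C l * gegenbauer (l + 1) n +
        C l * (X * gegenbauer (l + 1) n) := by
    simp only [map_add, map_natCast, map_one]; ring
  rw [h1, h2]
  ext k
  simp only [coeff_add, coeff_sub, coeff_C_mul, coeff_X_mul_derivative]
  rcases lt_or_ge (n + 1) k with hk | hk
  · rw [coeff_gegenbauer_of_lt _ hk, coeff_gegenbauer_of_lt _ (by omega),
      coeff_X_mul_gegenbauer_of_lt _ hk]
    ring
  · obtain ⟨j, hj⟩ := Nat.exists_eq_add_of_le hk
    have hj' : (n : ℝ) + 1 = k + j := by exact_mod_cast hj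
    refine mul_left_cancel₀ hl ?_
    linear_combination sq_mul_coeff_gegenbauer_pred l hj - sq_mul_coeff_X_mul_gegenbauer l hj -
      l * (gegenbauer l (n + 1)).coeff k * hj'

theorem gegenbauer_lowering {l : ℝ} (hl : l ≠ 0) (n : ℕ) :
    ((n : ℝ[X]) + 1) * ((n : ℝ[X]) + 1 + 2 * C l) * gegenbauer l (n + 1) =
      C l * ((2 * C l + 1) * (1 + X) * gegenbauer (l + 1) n +
        (1 - X) * ((n : ℝ[X]) * gegenbauer (l + 1) n - 2 * X * derivative (gegenbauer (l + 1) n))) := by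
  have h1 : ((n : ℝ[X]) + 1) * ((n : ℝ[X]) + 1 + 2 * C l) * gegenbauer l (n + 1) =
      C (((n : ℝ) + 1) * (n + 1 + 2 * l)) * gegenbauer l (n + 1) := by
    simp only [map_add, map_mul, map_natCast, map_one, map_ofNat]
  have h2 : C l * ((2 * C l + 1) * (1 + X) * gegenbauer (l + 1) n +
        (1 - X) * ((n : ℝ[X]) * gegenbauer (l + 1) n - 2 * X * derivative (gegenbauer (l + 1) n))) =
      C (l * (2 * l + 1 + n)) * gegenbauer (l + 1) n +
        C (l * (2 * l + 1 - n)) * (X * gegenbauer (l + 1) n) -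
        C (2 * l) * (X * derivative (gegenbauer (l + 1) n)) +
        C (2 * l) * (X * (X * derivative (gegenbauer (l + 1) n))) := by
    simp only [map_add, map_sub, map_mul, map_natCast, map_one, map_ofNat]; ring
  rw [h1, h2]
  ext k
  simp only [coeff_add, coeff_sub, coeff_C_mul, coeff_X_mul_derivative,
    coeff_X_mul_X_mul_derivative]
  rcases lt_or_ge (n + 1) k with hk | hk
  · rw [coeff_gegenbauer_of_lt _ hk, coeff_gegenbauer_of_lt _ (by omega),
      coeff_X_mul_gegenbauer_of_lt _ hk]
    ring
  · obtain ⟨j, hj⟩ := Nat.exists_eq_add_of_le hk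
    have hj' : (n : ℝ) = k + j - 1 := by rw [eq_sub_iff_add_eq]; exact_mod_cast hj
    have e1 := sq_mul_coeff_gegenbauer_pred l hj
    have e2 := sq_mul_coeff_X_mul_gegenbauer l hj
    refine mul_left_cancel₀ hl ?_
    rw [hj']
    linear_combination -(2 * l + (k + j) - 2 * k) * e1 - (2 * l - (k + j) + 2 * k) * e2

theorem gegenbauer_contiguous {l : ℝ} (hl : l ≠ 0) (n : ℕ) :
    (4 * C l + 2) * C l * gegenbauer (l + 1) (n + 1) =
      ((n : ℝ[X]) + 2 * C l + 2) * ((n : ℝ[X]) + 2 * C l + 1) * gegenbauer l (n + 1) -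
        C l * (1 - X) * ((n : ℝ[X]) * gegenbauer (l + 1) n - 2 * X * derivative (gegenbauer (l + 1) n)) := by
  have h1 : (4 * C l + 2) * C l * gegenbauer (l + 1) (n + 1) =
      C ((4 * l + 2) * l) * gegenbauer (l + 1) (n + 1) := by
    simp only [map_add, map_mul, map_ofNat]
  have h2 : ((n : ℝ[X]) + 2 * C l + 2) * ((n : ℝ[X]) + 2 * C l + 1) * gegenbauer l (n + 1) -
        C l * (1 - X) * ((n : ℝ[X]) * gegenbauer (l + 1) n - 2 * X * derivative (gegenbauer (l + 1) n)) =
      C (((n : ℝ) + 2 * l + 2) * (n + 2 * l + 1)) * gegenbauer l (n + 1) -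
        C (l * n) * gegenbauer (l + 1) n + C (l * n) * (X * gegenbauer (l + 1) n) +
        C (2 * l) * (X * derivative (gegenbauer (l + 1) n)) -
        C (2 * l) * (X * (X * derivative (gegenbauer (l + 1) n))) := by
    simp only [map_add, map_mul, map_natCast, map_one, map_ofNat]; ring
  rw [h1, h2]
  ext k
  simp only [coeff_add, coeff_sub, coeff_C_mul, coeff_X_mul_derivative,
    coeff_X_mul_X_mul_derivative]
  rcases lt_or_ge (n + 1) k with hk | hk
  · rw [coeff_gegenbauer_of_lt _ hk, coeff_gegenbauer_of_lt _ hk,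
      coeff_gegenbauer_of_lt _ (by omega), coeff_X_mul_gegenbauer_of_lt _ hk]
    ring
  · obtain ⟨j, hj⟩ := Nat.exists_eq_add_of_le hk
    have hj' : (n : ℝ) = k + j - 1 := by rw [eq_sub_iff_add_eq]; exact_mod_cast hj
    have e0 := sq_mul_coeff_gegenbauer_add_one l k j
    rw [← hj] at e0
    have e1 := sq_mul_coeff_gegenbauer_pred l hj
    have e2 := sq_mul_coeff_X_mul_gegenbauer l hj
    refine mul_left_cancel₀ hl ?_
    rw [hj']
    linear_combination (4 * l + 2) * e0 + (k + j - 1 - 2 * k) * e1 -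
      (k + j - 1 - 2 * (k - 1)) * e2

/-! ### Transition polynomials of the two-sided Ehrenfest process. -/

/-- The normalization of `ehrenfestPoly`. -/
noncomputable def ehrenfestConst (N r : ℕ) : ℝ := poch (1 / 2) r * N ! / (N + r)!

theorem ehrenfestConst_succ_right (N r : ℕ) :
    (N + r + 1) * ehrenfestConst N (r + 1) = ehrenfestConst N r * (r + 1 / 2) := by
  rw [ehrenfestConst, ehrenfestConst, poch_succ, ← add_assoc, Nat.factorial_succ]
  push_cast
  field_simp
  ring

/-- The probability that the two-sided Ehrenfest process on `{-N, …, N}` without catastrophes is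
in `r` at time `t`, as a polynomial in `u = exp (-4 λ t)`. -/
noncomputable def ehrenfestPoly (N r : ℕ) : ℝ[X] :=
  if r ≤ N then C (ehrenfestConst N r) * (1 - X) ^ r * gegenbauer (r + 1 / 2) (N - r) else 0

theorem ehrenfestPoly_of_lt {N r : ℕ} (h : N < r) : ehrenfestPoly N r = 0 :=
  if_neg (by omega)

theorem ehrenfestPoly_add (n r : ℕ) : ehrenfestPoly (n + r) r =
    C (ehrenfestConst (n + r) r) * (1 - X) ^ r * gegenbauer (r + 1 / 2) n := by
  rw [ehrenfestPoly, if_pos (by omega), Nat.add_sub_cancel]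

theorem one_sub_X_ne_zero : (1 - X : ℝ[X]) ≠ 0 := by
  intro h
  simpa using congrArg (eval 0) h

/-- The extra factor `1 - X` avoids the exponent `r - 1`, so that the formula also holds for `r =
0`. -/
theorem one_sub_X_mul_derivative_pow_mul (r : ℕ) (c : ℝ) (p : ℝ[X]) :
    (1 - X) * derivative (C c * (1 - X) ^ r * p) =
      C c * (1 - X) ^ r * ((1 - X) * derivative p - (r : ℝ[X]) * p) := by
  rw [mul_assoc, derivative_C_mul, derivative_mul, derivative_pow]
  simp only [derivative_sub, derivative_one, derivative_X, zero_sub]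
  rcases r with _ | r
  · simp
    ring
  · simp only [Nat.add_sub_cancel, map_natCast]
    ring

/-- One of two first-order ladder relations in `r`; adding it to `ehrenfestPoly_lowering` at a
shifted index eliminates the non-constant coefficients and leaves the forward equation. -/
theorem ehrenfestPoly_raising (N r : ℕ) :
    2 * X * (1 - X) * derivative (ehrenfestPoly N r) =
      (((N : ℝ[X]) - (r : ℝ[X])) * (1 - X) - 2 * (r : ℝ[X]) * X) * ehrenfestPoly N r -
        ((N : ℝ[X]) + (r : ℝ[X]) + 1) * (1 - X) * ehrenfestPoly N (r + 1) := by
  rcases lt_or_ge N r with h | h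
  · rw [ehrenfestPoly_of_lt h, ehrenfestPoly_of_lt (h.trans (Nat.lt_succ_self r))]
    simp
  obtain ⟨n, rfl⟩ := Nat.exists_eq_add_of_le' h
  have hd := one_sub_X_mul_derivative_pow_mul r (ehrenfestConst (n + r) r)
    (gegenbauer (r + 1 / 2) n)
  rw [← ehrenfestPoly_add] at hd
  have hc := congrArg C (ehrenfestConst_succ_right (n + r) r)
  simp only [map_mul, map_add, map_natCast, map_one] at hc
  rcases n with _ | n
  · rw [ehrenfestPoly_of_lt (by omega : 0 + r < r + 1)]
    rw [gegenbauer_zero, derivative_one] at hd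
    have he := ehrenfestPoly_add 0 r
    rw [gegenbauer_zero] at he
    push_cast at hd ⊢
    rw [he] at hd ⊢
    linear_combination 2 * X * hd
  · have hg := gegenbauer_derivative (l := r + 1 / 2) (by positivity) n
    have he := ehrenfestPoly_add (n + 1) r
    have he' := ehrenfestPoly_add n (r + 1)
    rw [show n + (r + 1) = n + 1 + r by ring] at he'
    rw [show ((r + 1 : ℕ) : ℝ) + 1 / 2 = r + 1 / 2 + 1 by push_cast; ring] at he'
    simp only [map_add, map_natCast] at hg
    rw [he']
    rw [he] at hd ⊢
    push_cast at hc ⊢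
    linear_combination 2 * X * hd + C (ehrenfestConst (n + 1 + r) r) * (1 - X) ^ (r + 1) * hg +
      (1 - X) ^ (r + 2) * gegenbauer (r + 1 / 2 + 1) n * hc

theorem ehrenfestPoly_lowering (N r : ℕ) :
    ((N : ℝ[X]) - (r : ℝ[X])) * (1 - X) * ehrenfestPoly N r =
      (2 * ((r : ℝ[X]) + 1) + ((N : ℝ[X]) - (r : ℝ[X]) - 1) * (1 - X)) * ehrenfestPoly N (r + 1) -
        2 * X * (1 - X) * derivative (ehrenfestPoly N (r + 1)) := by
  rcases Nat.lt_or_ge N (r + 1) with h | h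
  · rw [ehrenfestPoly_of_lt h]
    rcases Nat.lt_or_ge N r with h' | h'
    · rw [ehrenfestPoly_of_lt h']
      simp
    · obtain rfl : N = r := by omega
      simp
  obtain ⟨n, rfl⟩ := Nat.exists_eq_add_of_le' h
  have hd := one_sub_X_mul_derivative_pow_mul (r + 1) (ehrenfestConst (n + (r + 1)) (r + 1))
    (gegenbauer ((r + 1 : ℕ) + 1 / 2) n)
  have hg := gegenbauer_lowering (l := r + 1 / 2) (by positivity) n
  have hc := congrArg C (ehrenfestConst_succ_right (n + (r + 1)) r)
  have he := ehrenfestPoly_add (n + 1) r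
  have he' := ehrenfestPoly_add n (r + 1)
  rw [show n + 1 + r = n + (r + 1) by ring] at he
  rw [show ((r + 1 : ℕ) : ℝ) + 1 / 2 = r + 1 / 2 + 1 by push_cast; ring] at he' hd
  rw [← he'] at hd
  have hl : C ((r : ℝ) + 1 / 2) ≠ 0 := C_ne_zero.2 (by positivity)
  have h2 : 2 * C ((r : ℝ) + 1 / 2) = 2 * (r : ℝ[X]) + 1 := by
    rw [← map_ofNat C 2, ← map_mul, mul_add, mul_one_div_cancel two_ne_zero]
    simp
  simp only [map_mul, map_add (C : ℝ →+* ℝ[X]) _ (1 : ℝ), map_add (C : ℝ →+* ℝ[X]) _ (r : ℝ), map_natCast, map_one] at hc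
  rw [h2] at hg
  refine mul_left_cancel₀ hl ?_
  rw [he]
  rw [he'] at hd ⊢
  push_cast at hc hd ⊢
  linear_combination 2 * X * C ((r : ℝ) + 1 / 2) * hd -
    (n + 1) * (1 - X) ^ (r + 1) * gegenbauer (r + 1 / 2) (n + 1) * hc +
    C (ehrenfestConst (n + (r + 1)) (r + 1)) * (1 - X) ^ (r + 1) * hg

theorem ehrenfestConst_succ_left (N r : ℕ) :
    (N + r + 2) * ehrenfestConst (N + 1) (r + 1) = (N + 1) * ehrenfestConst N (r + 1) := by
  rw [ehrenfestConst, ehrenfestConst, show N + 1 + (r + 1) = N + (r + 1) + 1 by ring,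
    Nat.factorial_succ, Nat.factorial_succ]
  push_cast
  field_simp
  ring

/-- The forward equation of the two-sided Ehrenfest process at a non-zero state. -/
theorem ehrenfestPoly_forward (N r : ℕ) :
    -4 * (X * derivative (ehrenfestPoly N (r + 1))) =
      ((N : ℝ[X]) - (r : ℝ[X])) * ehrenfestPoly N r +
        ((N : ℝ[X]) + (r : ℝ[X]) + 2) * ehrenfestPoly N (r + 2) -
        2 * (N : ℝ[X]) * ehrenfestPoly N (r + 1) := by
  have h1 := ehrenfestPoly_raising N (r + 1)
  have h2 := ehrenfestPoly_lowering N r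
  push_cast at h1
  refine mul_left_cancel₀ one_sub_X_ne_zero ?_
  linear_combination -h1 - h2

/-- The forward equation of the two-sided Ehrenfest process at zero. -/
theorem ehrenfestPoly_forward_zero (N : ℕ) :
    -4 * (X * derivative (ehrenfestPoly N 0)) =
      2 * ((N : ℝ[X]) + 1) * ehrenfestPoly N 1 - 2 * (N : ℝ[X]) * ehrenfestPoly N 0 := by
  have h1 := ehrenfestPoly_raising N 0
  push_cast at h1
  refine mul_left_cancel₀ one_sub_X_ne_zero ?_
  linear_combination -2 * h1

theorem eval_one_ehrenfestPoly_succ (N r : ℕ) : (ehrenfestPoly N (r + 1)).eval 1 = 0 := by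
  rw [ehrenfestPoly]
  split_ifs <;> simp

/-! ### Division by `1 - X` and the passage from N + 1 to N. -/

/-- The polynomial `(r + 1) * ehrenfestPoly (N + 1) (r + 1) / (1 - X)`. -/
noncomputable def reducedPoly (N r : ℕ) : ℝ[X] :=
  if r ≤ N then C ((r + 1) * ehrenfestConst (N + 1) (r + 1)) * (1 - X) ^ r *
    gegenbauer (r + 1 / 2 + 1) (N - r) else 0

theorem reducedPoly_of_lt {N r : ℕ} (h : N < r) : reducedPoly N r = 0 :=
  if_neg (by omega)

theorem reducedPoly_add (n r : ℕ) : reducedPoly (n + r) r =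
    C ((r + 1) * ehrenfestConst (n + r + 1) (r + 1)) * (1 - X) ^ r *
      gegenbauer (r + 1 / 2 + 1) n := by
  rw [reducedPoly, if_pos (by omega), Nat.add_sub_cancel]

theorem one_sub_X_mul_reducedPoly (N r : ℕ) :
    (1 - X) * reducedPoly N r = ((r : ℝ[X]) + 1) * ehrenfestPoly (N + 1) (r + 1) := by
  rcases lt_or_ge N r with h | h
  · rw [reducedPoly_of_lt h, ehrenfestPoly_of_lt (by omega)]
    simp
  obtain ⟨n, rfl⟩ := Nat.exists_eq_add_of_le' h
  rw [reducedPoly_add, show n + r + 1 = n + (r + 1) by ring, ehrenfestPoly_add,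
    show ((r + 1 : ℕ) : ℝ) + 1 / 2 = r + 1 / 2 + 1 by push_cast; ring]
  simp only [map_mul, map_add (C : ℝ →+* ℝ[X]) _ (1 : ℝ), map_natCast, map_one]
  ring

theorem C_natCast_add_half (r : ℕ) : 2 * C ((r : ℝ) + 1 / 2) = 2 * (r : ℝ[X]) + 1 := by
  rw [← map_ofNat C 2, ← map_mul, mul_add, mul_one_div_cancel two_ne_zero]
  simp

/-- Behind it is the generating function φ^N, with φ(z) = (1 + u)/2 + (1 - u)(z + 1/z)/4: apply z
d/dz to φ^(N+1) and compare coefficients of z^(r+1). Here it is derived from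
`gegenbauer_contiguous`. -/
theorem four_mul_reducedPoly (N r : ℕ) :
    4 * reducedPoly N r =
      ((N : ℝ[X]) + 1) * (ehrenfestPoly N r - ehrenfestPoly N (r + 2)) := by
  rcases lt_or_ge N r with h | h
  · rw [reducedPoly_of_lt h, ehrenfestPoly_of_lt h, ehrenfestPoly_of_lt (by omega)]
    simp
  obtain ⟨n, rfl⟩ := Nat.exists_eq_add_of_le' h
  have h2 := C_natCast_add_half r
  have hl : C ((r : ℝ) + 1 / 2) ≠ 0 := C_ne_zero.2 (by positivity)
  have c1 := congrArg C (ehrenfestConst_succ_right (n + r) r)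
  have c2 := congrArg C (ehrenfestConst_succ_left (n + r) r)
  simp only [map_mul, map_add (C : ℝ →+* ℝ[X]) _ (1 : ℝ), map_add (C : ℝ →+* ℝ[X]) _ (r : ℝ),
    map_add (C : ℝ →+* ℝ[X]) _ (2 : ℝ), map_natCast, map_one, map_ofNat] at c1 c2
  rcases n with _ | n
  · have he := ehrenfestPoly_add 0 r
    have hr := reducedPoly_add 0 r
    rw [ehrenfestPoly_of_lt (by omega : 0 + r < r + 2)]
    rw [gegenbauer_zero] at he hr
    simp only [map_mul, map_add (C : ℝ →+* ℝ[X]) _ (1 : ℝ), map_natCast, map_one] at hr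
    rw [he, hr]
    refine mul_left_cancel₀ hl ?_
    push_cast at c1 c2 ⊢
    linear_combination (1 - X) ^ r * (2 * C ((r : ℝ) + 1 / 2) * c2 + (r + 1) * c1) +
      (r + 1) * C (ehrenfestConst (0 + r) (r + 1)) * (1 - X) ^ r * h2
  · have hd := one_sub_X_mul_derivative_pow_mul (r + 1) (ehrenfestConst (n + (r + 1)) (r + 1))
      (gegenbauer ((r + 1 : ℕ) + 1 / 2) n)
    have hg := gegenbauer_contiguous (l := r + 1 / 2) (by positivity) n
    have he := ehrenfestPoly_add (n + 1) r
    have he' := ehrenfestPoly_add n (r + 1)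
    have hr := reducedPoly_add (n + 1) r
    have hq := ehrenfestPoly_raising (n + (r + 1)) (r + 1)
    simp only [map_mul, map_add (C : ℝ →+* ℝ[X]) _ (1 : ℝ), map_natCast, map_one] at hr
    rw [show ((r + 1 : ℕ) : ℝ) + 1 / 2 = r + 1 / 2 + 1 by push_cast; ring] at he' hd
    rw [← he'] at hd
    set D := derivative (ehrenfestPoly (n + (r + 1)) (r + 1))
    rw [he', show r + 1 + 1 = r + 2 from rfl] at hq
    rw [show n + (r + 1) = n + 1 + r by ring] at hd hq
    rw [he, hr]
    have hk : ((n : ℝ[X]) + 2 * (r : ℝ[X]) + 3) ≠ 0 := by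
      exact_mod_cast (Nat.cast_ne_zero (R := ℝ[X])).2 (by omega : n + 2 * r + 3 ≠ 0)
    refine mul_left_cancel₀ one_sub_X_ne_zero (mul_left_cancel₀ hl (mul_left_cancel₀ hk ?_))
    have hg' : 4 * ((r : ℝ[X]) + 1) * C ((r : ℝ) + 1 / 2) * gegenbauer (r + 1 / 2 + 1) (n + 1) =
        ((n : ℝ[X]) + 2 * (r : ℝ[X]) + 3) * ((n : ℝ[X]) + 2 * (r : ℝ[X]) + 2) * gegenbauer (r + 1 / 2) (n + 1) -
          C ((r : ℝ) + 1 / 2) * (1 - X) * ((n : ℝ[X]) * gegenbauer (r + 1 / 2 + 1) n -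
            2 * X * derivative (gegenbauer (r + 1 / 2 + 1) n)) := by
      linear_combination hg + (-2 * C ((r : ℝ) + 1 / 2) * gegenbauer (r + 1 / 2 + 1) (n + 1) +
        gegenbauer (r + 1 / 2) (n + 1) * (2 * (n : ℝ[X]) + 2 * C ((r : ℝ) + 1 / 2) + 2 * (r : ℝ[X]) + 4)) * h2
    push_cast at c1 c2 hd hq ⊢
    linear_combination ((n : ℝ[X]) + 2 * (r : ℝ[X]) + 3) * C (ehrenfestConst (n + 1 + r + 1) (r + 1)) *
        (1 - X) ^ (r + 1) * hg' +
      ((n : ℝ[X]) + 2 * (r : ℝ[X]) + 3) * (1 - X) ^ (r + 1) * gegenbauer (r + 1 / 2) (n + 1) *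
        (((n : ℝ[X]) + 2 * (r : ℝ[X]) + 2) * c2 + ((n : ℝ[X]) + (r : ℝ[X]) + 2) * c1) -
      (1 - X) ^ (r + 2) * C ((r : ℝ) + 1 / 2) * ((n : ℝ[X]) * gegenbauer (r + 1 / 2 + 1) n -
        2 * X * derivative (gegenbauer (r + 1 / 2 + 1) n)) * c2 +
      C ((r : ℝ) + 1 / 2) * ((n : ℝ[X]) + (r : ℝ[X]) + 2) * (hq - 2 * X * hd)

/-- The point u = 1 is time 0, so this is the initial condition. In the lowering relation at `r = 0`
a factor `1 - X` cancels, and `four_mul_reducedPoly` links the value for N + 1 to that for N. -/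
theorem eval_one_ehrenfestPoly_zero (N : ℕ) : (ehrenfestPoly N 0).eval 1 = 1 := by
  induction N with
  | zero => simp [ehrenfestPoly, gegenbauer_zero, ehrenfestConst, poch_zero]
  | succ N ih =>
    have h1 := ehrenfestPoly_lowering (N + 1) 0
    have h2 := one_sub_X_mul_reducedPoly N 0
    have h3 := congrArg (eval 1) (four_mul_reducedPoly N 0)
    simp only [Nat.cast_zero, zero_add, one_mul] at h1 h2
    rw [← h2] at h1
    simp only [derivative_mul, derivative_sub, derivative_one, derivative_X, zero_sub] at h1
    have h4 : ((N : ℝ[X]) + 1) * ehrenfestPoly (N + 1) 0 =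
        (2 + (N : ℝ[X]) * (1 - X)) * reducedPoly N 0 + 2 * X * reducedPoly N 0 -
          2 * X * (1 - X) * derivative (reducedPoly N 0) := by
      refine mul_left_cancel₀ one_sub_X_ne_zero ?_
      push_cast at h1
      linear_combination h1
    have h5 := congrArg (eval 1) h4
    simp [ih, eval_one_ehrenfestPoly_succ] at h3 h5
    have hN : (N : ℝ) + 1 ≠ 0 := by positivity
    refine mul_left_cancel₀ hN ?_
    linear_combination h5 + h3

/-! ### Stationary probabilities as integrals of the transition polynomials. -/

/-- The functional `p ↦ ∫₀¹ x u^(x - 1) p(u) du`. -/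
noncomputable def betaFunctional (x : ℝ) : ℝ[X] →ₗ[ℝ] ℝ :=
  Polynomial.lsum fun k => (x / (x + k)) • LinearMap.id

theorem betaFunctional_monomial (x : ℝ) (k : ℕ) (a : ℝ) :
    betaFunctional x (monomial k a) = x / (x + k) * a := by
  simp [betaFunctional, Polynomial.lsum_apply, sum_monomial_index]

theorem betaFunctional_C_mul (x a : ℝ) (p : ℝ[X]) :
    betaFunctional x (C a * p) = a * betaFunctional x p := by
  rw [← smul_eq_C_mul, map_smul, smul_eq_mul]

/-- Integration by parts; it turns forward equations into balance equations, the boundary value at 1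
becoming the inflow by resets. -/
theorem betaFunctional_X_mul_derivative {x : ℝ} (hx : 0 < x) (p : ℝ[X]) :
    betaFunctional x (X * derivative p) = x * (p.eval 1 - betaFunctional x p) := by
  induction p using Polynomial.induction_on' with
  | add p q hp hq =>
    rw [derivative_add, mul_add, map_add, hp, hq, eval_add, map_add]
    ring
  | monomial k a =>
    have h : X * derivative (monomial k a) = monomial k (k * a) := by
      ext i
      rw [coeff_X_mul_derivative, coeff_monomial, coeff_monomial]
      split_ifs with h
      · rw [h]
      · rw [mul_zero]
    have hk : x + k ≠ 0 := by positivity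
    rw [h, betaFunctional_monomial, betaFunctional_monomial, eval_monomial, one_pow, mul_one]
    field_simp
    ring

theorem betaFunctional_X_pow_mul {x : ℝ} (hx : 0 < x) (r k : ℕ) :
    betaFunctional x (X ^ k * (1 - X) ^ r) = x * r ! / poch (x + k) (r + 1) := by
  induction r generalizing k with
  | zero =>
    rw [pow_zero, mul_one, ← monomial_one_right_eq_X_pow, betaFunctional_monomial]
    simp [poch_succ, poch_zero]
  | succ r ih =>
    have h : (X ^ k * (1 - X) ^ (r + 1) : ℝ[X]) =
        X ^ k * (1 - X) ^ r - X ^ (k + 1) * (1 - X) ^ r := by ring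
    have h1 := poch_pos (show 0 < x + k by positivity) (r + 1)
    have h4 := poch_succ_left (x + k) (r + 1)
    have h5 := poch_succ (x + k) (r + 1)
    have hk : x + k ≠ 0 := by positivity
    rw [h, map_sub, ih, ih, Nat.factorial_succ]
    push_cast at h5 ⊢
    rw [← add_assoc, eq_div_of_mul_eq hk ((mul_comm _ _).trans h4.symm),
      eq_div_of_mul_eq (by positivity : x + k + (r + 1) ≠ 0) h5.symm]
    field_simp
    ring

/-- The stationary probability of the state `r` of the two-sided Ehrenfest process with
catastrophes at rate `4 λ x`. -/
noncomputable def twoSidedProb (N : ℕ) (x : ℝ) (r : ℕ) : ℝ := betaFunctional x (ehrenfestPoly N r)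

theorem twoSidedProb_of_lt {N r : ℕ} (x : ℝ) (h : N < r) : twoSidedProb N x r = 0 := by
  rw [twoSidedProb, ehrenfestPoly_of_lt h, map_zero]

theorem twoSidedProb_balance (N : ℕ) {x : ℝ} (hx : 0 < x) (r : ℕ) :
    (N - r) * twoSidedProb N x r + (N + r + 2) * twoSidedProb N x (r + 2) =
      (2 * N + 4 * x) * twoSidedProb N x (r + 1) := by
  have h1 : C (-4 : ℝ) * (X * derivative (ehrenfestPoly N (r + 1))) =
      C ((N : ℝ) - r) * ehrenfestPoly N r + C ((N : ℝ) + r + 2) * ehrenfestPoly N (r + 2) -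
        C (2 * (N : ℝ)) * ehrenfestPoly N (r + 1) := by
    simp only [map_add, map_sub, map_mul, map_neg, map_natCast, map_ofNat]
    exact ehrenfestPoly_forward N r
  have h2 := congrArg (betaFunctional x) h1
  simp only [map_sub (betaFunctional x), map_add (betaFunctional x), betaFunctional_C_mul,
    betaFunctional_X_mul_derivative hx, eval_one_ehrenfestPoly_succ] at h2
  simp only [twoSidedProb]
  linear_combination -h2

theorem twoSidedProb_balance_zero (N : ℕ) {x : ℝ} (hx : 0 < x) :
    2 * (N + 1) * twoSidedProb N x 1 + 4 * x = (2 * N + 4 * x) * twoSidedProb N x 0 := by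
  have h1 : C (-4 : ℝ) * (X * derivative (ehrenfestPoly N 0)) =
      C (2 * ((N : ℝ) + 1)) * ehrenfestPoly N 1 - C (2 * (N : ℝ)) * ehrenfestPoly N 0 := by
    simp only [map_add, map_mul, map_neg, map_natCast, map_ofNat, map_one]
    exact ehrenfestPoly_forward_zero N
  have h2 := congrArg (betaFunctional x) h1
  simp only [map_sub, betaFunctional_C_mul,
    betaFunctional_X_mul_derivative hx, eval_one_ehrenfestPoly_zero] at h2
  simp only [twoSidedProb]
  linear_combination -h2

/-- By symmetry r ↔ -r this is total mass 1. Summing the balance equations telescopes. -/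
theorem twoSidedProb_sum (N : ℕ) {x : ℝ} (hx : 0 < x) :
    twoSidedProb N x 0 + 2 * ∑ r ∈ Finset.range N, twoSidedProb N x (r + 1) = 1 := by
  have h : ∀ m : ℕ, 4 * x * ∑ r ∈ Finset.range m, twoSidedProb N x (r + 1) =
      N * twoSidedProb N x 0 - (N + 1) * twoSidedProb N x 1 - (N - m) * twoSidedProb N x m +
        (N + m + 1) * twoSidedProb N x (m + 1) := by
    intro m
    induction m with
    | zero => simp
    | succ m ih =>
      rw [Finset.sum_range_succ, mul_add, ih]
      push_cast
      linear_combination -twoSidedProb_balance N hx m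
  have h1 := h N
  rw [twoSidedProb_of_lt x (Nat.lt_succ_self N)] at h1
  refine mul_left_cancel₀ (by positivity : 2 * x ≠ 0) ?_
  linear_combination h1 - 1 / 2 * twoSidedProb_balance_zero N hx

/-- The functional of `reducedPoly`; it is proportional to `twoSidedProb (N + 1) x (r + 1)`
for `y = x + 1 / 2`. -/
noncomputable def reducedProb (N : ℕ) (y : ℝ) (r : ℕ) : ℝ := betaFunctional y (reducedPoly N r) / y

theorem reducedProb_of_lt {N r : ℕ} (y : ℝ) (h : N < r) : reducedProb N y r = 0 := by
  rw [reducedProb, reducedPoly_of_lt h, map_zero, zero_div]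

theorem four_mul_reducedProb (N : ℕ) {y : ℝ} (hy : 0 < y) (r : ℕ) :
    4 * y * reducedProb N y r =
      (N + 1) * (twoSidedProb N y r - twoSidedProb N y (r + 2)) := by
  have h1 : C (4 : ℝ) * reducedPoly N r =
      C ((N : ℝ) + 1) * (ehrenfestPoly N r - ehrenfestPoly N (r + 2)) := by
    simp only [map_add, map_natCast, map_ofNat, map_one]
    exact four_mul_reducedPoly N r
  have h2 := congrArg (betaFunctional y) h1
  simp only [betaFunctional_C_mul, map_sub] at h2
  simp only [reducedProb, twoSidedProb]
  rw [← h2]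
  field_simp

/-- For `y = x + 1 / 2` this is the recurrence of `twoSidedProb (N + 1) x (r + 1)`, since 2N + 4y =
2(N + 1) + 4x. -/
theorem reducedProb_balance (N : ℕ) {y : ℝ} (hy : 0 < y) (r : ℕ) :
    (N - r) * reducedProb N y r + (N + r + 4) * reducedProb N y (r + 2) =
      (2 * N + 4 * y) * reducedProb N y (r + 1) := by
  have h1 := twoSidedProb_balance N hy r
  have h2 := twoSidedProb_balance N hy (r + 2)
  have s0 := four_mul_reducedProb N hy r
  have s1 := four_mul_reducedProb N hy (r + 1)
  have s2 := four_mul_reducedProb N hy (r + 2)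
  rw [show r + 2 + 1 = r + 3 from rfl, show r + 2 + 2 = r + 4 from rfl] at h2
  rw [show r + 1 + 2 = r + 3 from rfl] at s1
  rw [show r + 2 + 2 = r + 4 from rfl] at s2
  push_cast at h2
  refine mul_left_cancel₀ (by positivity : 4 * y ≠ 0) ?_
  linear_combination (N - r : ℝ) * s0 + (N + r + 4 : ℝ) * s2 - (2 * N + 4 * y) * s1 +
    (N + 1 : ℝ) * (h1 - h2)

theorem poch_mul_twoSidedProb (N : ℕ) {x : ℝ} (hx : 0 < x) {r : ℕ} (hr : r ≤ N) :
    poch (1 + x) (N + 1) * twoSidedProb (N + 1) x (r + 1) =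
      poch (1 / 2 + x) (N + 1) * reducedProb N (x + 1 / 2) r := by
  have hy : 0 < x + 1 / 2 := by positivity
  -- Downward induction on `r`, with two consecutive values carried along. Above the top state both
  -- sides vanish, and at the top both are explicit beta integrals, which fixes the ratio.
  suffices h : ∀ i r : ℕ, r + i = N →
      poch (1 + x) (N + 1) * twoSidedProb (N + 1) x (r + 1) =
        poch (1 / 2 + x) (N + 1) * reducedProb N (x + 1 / 2) r ∧
      poch (1 + x) (N + 1) * twoSidedProb (N + 1) x (r + 2) =
        poch (1 / 2 + x) (N + 1) * reducedProb N (x + 1 / 2) (r + 1) from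
    (h (N - r) r (by omega)).1
  intro i
  induction i with
  | zero =>
    rintro r rfl
    constructor
    · have h1 : twoSidedProb (r + 1) x (r + 1) =
          ehrenfestConst (r + 1) (r + 1) * (x * (r + 1)! / poch x (r + 1 + 1)) := by
        have h := ehrenfestPoly_add 0 (r + 1)
        rw [zero_add, gegenbauer_zero, mul_one] at h
        have h' := betaFunctional_X_pow_mul hx (r + 1) 0
        rw [pow_zero, one_mul, Nat.cast_zero, add_zero] at h'
        rw [twoSidedProb, h, betaFunctional_C_mul, h']
      have h2 : reducedProb r (x + 1 / 2) r = (r + 1) * ehrenfestConst (r + 1) (r + 1) *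
          (r ! / poch (x + 1 / 2) (r + 1)) := by
        have h := reducedPoly_add 0 r
        rw [zero_add, gegenbauer_zero, mul_one] at h
        have h' := betaFunctional_X_pow_mul hy r 0
        rw [pow_zero, one_mul, Nat.cast_zero, add_zero] at h'
        rw [reducedProb, h, betaFunctional_C_mul, h']
        field_simp
      have hp := (poch_pos (show 0 < x + 1 by positivity) (r + 1)).ne'
      have hq := (poch_pos hy (r + 1)).ne'
      rw [add_zero, h1, h2, poch_succ_left x, add_comm 1 x, add_comm (1 / 2) x,
        Nat.factorial_succ]
      generalize poch (x + 1 / 2) (r + 1) = q at hq ⊢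
      push_cast
      field_simp
    · rw [twoSidedProb_of_lt _ (by omega), reducedProb_of_lt _ (by omega), mul_zero, mul_zero]
  | succ i ih =>
    intro r hri
    obtain ⟨ih1, ih2⟩ := ih (r + 1) (by omega)
    refine ⟨?_, ih1⟩
    have h1 := twoSidedProb_balance (N + 1) hx (r + 1)
    have h2 := reducedProb_balance N hy r
    have hN : (N : ℝ) - r ≠ 0 := by
      have : (N : ℝ) = r + (i + 1) := by exact_mod_cast hri.symm
      rw [this, add_sub_cancel_left]
      positivity
    refine mul_left_cancel₀ hN ?_
    rw [show r + 1 + 1 = r + 2 from rfl, show r + 1 + 2 = r + 3 from rfl] at h1 ih2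
    rw [show r + 1 + 1 = r + 2 from rfl] at ih1
    rw [show r + 1 + 1 = r + 2 from rfl] at ih2
    push_cast at h1
    linear_combination poch (1 + x) (N + 1) * h1 - poch (1 / 2 + x) (N + 1) * h2 +
      (2 * N + 4 * x + 2) * ih1 - (N + r + 4 : ℝ) * ih2

theorem poch_mul_twoSidedProb_zero (N : ℕ) {x : ℝ} (hx : 0 < x) :
    poch (1 + x) N * twoSidedProb N x 0 = poch (1 / 2 + x) N := by
  induction N generalizing x with
  | zero =>
    have h := betaFunctional_X_pow_mul hx 0 0
    simp only [pow_zero, one_mul, Nat.cast_zero, add_zero, zero_add, poch_succ, poch_zero,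
      Nat.factorial_zero, Nat.cast_one, mul_one, div_self hx.ne'] at h
    simp [poch_zero, twoSidedProb, ehrenfestPoly, gegenbauer_zero, ehrenfestConst, h]
  | succ N ih =>
    have hy : 0 < x + 1 / 2 := by positivity
    have ih' := ih hy
    have h1 := twoSidedProb_balance_zero (N + 1) hx
    have h2 := poch_mul_twoSidedProb N hx (Nat.zero_le N)
    have h3 := four_mul_reducedProb N hy 0
    have h4 := twoSidedProb_balance N hy 0
    have h5 := twoSidedProb_balance_zero N hy
    have h6 := poch_succ (1 + x) N
    have h7 := poch_succ_left (1 / 2 + x) N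
    rw [show (1 : ℝ) + (x + 1 / 2) = 1 / 2 + x + 1 by ring,
      show (1 : ℝ) / 2 + (x + 1 / 2) = 1 + x by ring] at ih'
    simp only [zero_add] at h2 h3 h4
    push_cast at h1 h4
    refine mul_left_cancel₀ (by positivity : 2 * ((N : ℝ) + 1) + 4 * x ≠ 0) ?_
    set p := poch (1 + x) N
    set w := poch (1 / 2 + x + 1) N
    rw [h7] at h2 ⊢
    linear_combination -poch (1 + x) (N + 1) * h1 + 2 * (N + 2 : ℝ) * h2 + 4 * x * h6 +
      (N + 2 : ℝ) * w / 2 * h3 - (N + 1 : ℝ) * w / 2 * h4 -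
      (2 * N + 4 * x + 2) * w / 4 * h5 + (-(4 * x) * (N + 1 + x)) * ih'

/-! ### Terminating ₃F₂ sums. -/

theorem poch_add (a : ℝ) (m k : ℕ) : poch a (m + k) = poch a m * poch (a + m) k := by
  induction k with
  | zero => simp [poch_zero]
  | succ k ih =>
    rw [← add_assoc, poch_succ, poch_succ, ih]
    push_cast
    ring

theorem poch_one (n : ℕ) : poch 1 n = n ! := by
  induction n with
  | zero => simp [poch_zero]
  | succ n ih =>
    rw [poch_succ, ih, Nat.factorial_succ]
    push_cast
    ring

theorem poch_reflect (l : ℝ) (k j : ℕ) :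
    poch (1 - l - (k + j)) k * poch l j = (-1) ^ k * poch l (k + j) := by
  induction k with
  | zero => simp [poch_zero]
  | succ k ih =>
    rw [poch_succ_left, show k + 1 + j = k + j + 1 by ring, poch_succ,
      show 1 - l - ((k + 1 : ℕ) + (j : ℝ)) + 1 = 1 - l - (k + j) by push_cast; ring]
    push_cast
    linear_combination -(l + k + j) * ih

theorem poch_neg_of_lt {n k : ℕ} (h : n < k) : poch (-(n : ℝ)) k = 0 := by
  obtain ⟨j, rfl⟩ := Nat.exists_eq_add_of_lt h
  rw [show n + j + 1 = n + (j + 1) by ring, poch_add, poch_succ_left]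
  simp

theorem Gamma_add_natCast {a : ℝ} (ha : 0 < a) (n : ℕ) :
    Real.Gamma (a + n) = poch a n * Real.Gamma a := by
  induction n with
  | zero => simp [poch_zero]
  | succ n ih =>
    rw [Nat.cast_succ, ← add_assoc, Real.Gamma_add_one (by positivity), ih, poch_succ]
    ring

theorem factorial_two_mul_eq (n : ℕ) : ((2 * n)! : ℝ) = 4 ^ n * n ! * poch (1 / 2) n := by
  induction n with
  | zero => simp [poch_zero]
  | succ n ih =>
    rw [show 2 * (n + 1) = 2 * n + 1 + 1 by ring, Nat.factorial_succ, Nat.factorial_succ,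
      Nat.factorial_succ, poch_succ]
    push_cast
    rw [ih]
    ring

/-- Reflecting the Pochhammer symbols of `-n` and `1 - l - n` turns the summand into a product of
two binomial coefficients, as in `gegenbauer`; the ratio of the remaining two symbols leaves the
beta integral factor `1 / poch (a + k) m`. -/
theorem hyp32_terminating {l a : ℝ} (hl : 0 < l) (ha : 0 < a) (n m : ℕ) :
    hyp32 (-(n : ℝ)) l a (1 - l - n) (a + m) 1 * poch (a + m) n * binomCoeff l n =
      poch a (m + n) *
        ∑ k ∈ Finset.range (n + 1), binomCoeff l k * binomCoeff l (n - k) / poch (a + k) m := by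
  rw [hyp32, tsum_eq_sum (s := Finset.range (n + 1)), poch_add, Finset.sum_mul, Finset.sum_mul,
    Finset.mul_sum]
  · refine Finset.sum_congr rfl fun k hk => ?_
    obtain ⟨j, rfl⟩ := Nat.exists_eq_add_of_le (Nat.lt_succ_iff.1 (Finset.mem_range.1 hk))
    have h1 := poch_reflect 1 k j
    have h2 := poch_reflect l k j
    rw [sub_self, zero_sub, poch_one, poch_one] at h1
    have h3 : poch a k * poch (a + k) m = poch a m * poch (a + m) k := by
      rw [← poch_add, ← poch_add, add_comm]
    have p1 := (poch_pos hl j).ne'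
    have p2 := (poch_pos hl (k + j)).ne'
    have p3 := (poch_pos (show 0 < a + m by positivity) k).ne'
    have p4 := (poch_pos (show 0 < a + k by positivity) m).ne'
    have hs : ((-1 : ℝ)) ^ k ≠ 0 := by simp
    have p5 : poch (1 - l - (k + j)) k ≠ 0 := by
      intro h
      rw [h, zero_mul] at h2
      exact mul_ne_zero hs p2 h2.symm
    have f1 : ((k + j)! : ℝ) ≠ 0 := by positivity
    have f2 : (j ! : ℝ) ≠ 0 := by positivity
    have e1 : poch (-((k : ℝ) + j)) k = (-1) ^ k * (k + j)! / j ! := eq_div_of_mul_eq f2 h1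
    have e2 : poch (1 - l - (k + j)) k = (-1) ^ k * poch l (k + j) / poch l j :=
      eq_div_of_mul_eq p1 h2
    have e3 : poch a k = poch a m * poch (a + m) k / poch (a + k) m := eq_div_of_mul_eq p4 h3
    rw [Nat.add_sub_cancel_left]
    push_cast
    rw [e1, e2, e3, binomCoeff, binomCoeff, binomCoeff]
    field_simp
    simp
  · intro k hk
    rw [poch_neg_of_lt (by simpa using hk)]
    simp

theorem betaFunctional_mul_gegenbauer {x : ℝ} (hx : 0 < x) (l : ℝ) (r n : ℕ) :
    betaFunctional x ((1 - X) ^ r * gegenbauer l n) =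
      x * r ! * ∑ k ∈ Finset.range (n + 1),
        binomCoeff l k * binomCoeff l (n - k) / poch (x + k) (r + 1) := by
  rw [gegenbauer, Finset.mul_sum, map_sum, Finset.mul_sum]
  refine Finset.sum_congr rfl fun k _ => ?_
  rw [← C_mul_X_pow_eq_monomial, mul_left_comm, betaFunctional_C_mul, mul_comm ((1 - X) ^ r),
    betaFunctional_X_pow_mul hx]
  ring

/-- The left side is the transition polynomial at u = 0, that is, the equilibrium law of 2N
independent fair spins. -/
theorem ehrenfestConst_mul_binomCoeff (n r : ℕ) :
    ehrenfestConst (n + r) r * binomCoeff (r + 1 / 2) n =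
      (1 / 4) ^ (n + r) * ((2 * (n + r)).choose n : ℝ) := by
  have h1 := factorial_two_mul_eq (n + r)
  have h2 := poch_add (1 / 2) r n
  rw [add_comm r n, add_comm (1 / 2 : ℝ) r] at h2
  have h3 : ((2 * (n + r)).choose n : ℝ) = (2 * (n + r))! / (n ! * (n + r + r)!) := by
    rw [Nat.cast_choose ℝ (by omega), show 2 * (n + r) - n = n + r + r by omega]
  rw [h3, h1, h2, ehrenfestConst, binomCoeff, one_div_pow]
  field_simp

theorem hyp32_eq_twoSidedProb {x : ℝ} (hx : 0 < x) (n r : ℕ) :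
    (1 / 4) ^ (n + r) * ((2 * (n + r)).choose n : ℝ) * r ! *
        (hyp32 (-(n : ℝ)) (1 / 2 + r) x (1 / 2 - (n + r)) (r + 1 + x) 1 * poch (1 + r + x) n) =
      poch (1 + x) (n + r) * twoSidedProb (n + r) x r := by
  have h := hyp32_terminating (l := r + 1 / 2) (by positivity) hx n (r + 1)
  rw [show 1 - ((r : ℝ) + 1 / 2) - n = 1 / 2 - (n + r) by ring,
    show x + ((r + 1 : ℕ) : ℝ) = r + 1 + x by push_cast; ring, show r + 1 + n = n + r + 1 by ring,
    poch_succ_left x, add_comm (r : ℝ) (1 / 2)] at h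
  rw [twoSidedProb, ehrenfestPoly_add, mul_assoc (C _), betaFunctional_C_mul,
    betaFunctional_mul_gegenbauer hx, ← ehrenfestConst_mul_binomCoeff, add_comm (1 : ℝ) r,
    add_comm (r : ℝ) (1 / 2), add_comm 1 x]
  linear_combination ehrenfestConst (n + r) r * r ! * h

theorem hyp32_eq_reducedProb {x : ℝ} (hx : 0 < x) (n r : ℕ) :
    (1 / 4) ^ (n + (r + 1)) * ((2 * (n + (r + 1))).choose n : ℝ) * (r + 1)! *
        (hyp32 (-(n : ℝ)) (1 / 2 + (r + 1 : ℕ)) (x + 1 / 2) (1 / 2 - (n + (r + 1 : ℕ)))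
          ((r + 1 : ℕ) + 1 / 2 + x) 1 * poch (1 / 2 + (r + 1 : ℕ) + x) n) =
      poch (1 / 2 + x) (n + (r + 1)) * reducedProb (n + r) (x + 1 / 2) r := by
  have hy : 0 < x + 1 / 2 := by positivity
  have h := hyp32_terminating (l := (r + 1 : ℕ) + 1 / 2) (by positivity) hy n (r + 1)
  rw [show 1 - (((r + 1 : ℕ) : ℝ) + 1 / 2) - n = 1 / 2 - (n + (r + 1 : ℕ)) by ring,
    show x + 1 / 2 + ((r + 1 : ℕ) : ℝ) = (r + 1 : ℕ) + 1 / 2 + x by ring,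
    add_comm (r + 1) n, add_comm ((r + 1 : ℕ) : ℝ) (1 / 2)] at h
  rw [reducedProb, reducedPoly_add, mul_assoc (C _), betaFunctional_C_mul,
    show (r : ℝ) + 1 / 2 + 1 = 1 / 2 + (r + 1 : ℕ) by push_cast; ring,
    betaFunctional_mul_gegenbauer hy, ← ehrenfestConst_mul_binomCoeff,
    add_comm ((r + 1 : ℕ) : ℝ) (1 / 2), add_comm (1 / 2) x, Nat.factorial_succ,
    show n + r + 1 = n + (r + 1) by ring]
  set S := ∑ k ∈ Finset.range (n + 1), binomCoeff (1 / 2 + (r + 1 : ℕ)) k *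
    binomCoeff (1 / 2 + (r + 1 : ℕ)) (n - k) / poch (x + 1 / 2 + k) (r + 1)
  have e : ∀ c : ℝ, c * ((x + 1 / 2) * r ! * S) / (x + 1 / 2) = c * (r ! * S) := fun c => by
    field_simp
  rw [e]
  push_cast at h ⊢
  linear_combination ehrenfestConst (n + (r + 1)) (r + 1) * (r + 1) * r ! * h

/-! ### Balance equations of the level chain for equal rates. -/

theorem sum_fin_ite_eq (N a : ℕ) (f : ℕ → ℝ) :
    (∑ i : Fin (N + 1), if (i : ℕ) = a then f i else 0) = if a ≤ N then f a else 0 := by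
  rw [Fin.sum_univ_eq_sum_range (fun i => if i = a then f i else 0) (N + 1),
    Finset.sum_ite_eq']
  simp

theorem levelRate_apply (N : ℕ) (lam xi : ℝ) (i k : Fin (N + 1)) :
    levelRate N lam lam xi i k =
      (if (k : ℕ) = i + 1 then lam * ((N : ℝ) - (i : ℕ)) else 0) +
      (if (i : ℕ) = k + 1 then lam * ((N : ℝ) + (i : ℕ)) else 0) +
      (if (i : ℕ) ≠ 0 ∧ (k : ℕ) = 0 then xi else 0) := by
  simp only [levelRate, samePhaseRate, Matrix.of_apply]
  by_cases hi : (i : ℕ) = 0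
  · simp [hi]
  · simp [hi]

theorem sum_levelRate (N : ℕ) (lam xi : ℝ) (i : Fin (N + 1)) :
    ∑ k, levelRate N lam lam xi i k =
      lam * ((N : ℝ) - (i : ℕ)) + if (i : ℕ) = 0 then 0 else lam * ((N : ℝ) + (i : ℕ)) + xi := by
  simp only [levelRate_apply, Finset.sum_add_distrib]
  rw [sum_fin_ite_eq N (i + 1) fun _ => lam * ((N : ℝ) - (i : ℕ)), add_assoc]
  congr 1
  · split_ifs with h
    · rfl
    · have : (i : ℕ) = N := by omega
      rw [this, sub_self, mul_zero]
  · obtain ⟨i, hi⟩ := i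
    rcases i with _ | i
    · simp
    · have h1 := sum_fin_ite_eq N i fun _ => lam * ((N : ℝ) + (i + 1 : ℕ))
      have h2 := sum_fin_ite_eq N 0 fun _ => xi
      rw [if_pos (by omega)] at h1 h2
      simpa [eq_comm] using congrArg₂ (· + ·) h1 h2

theorem vecMul_generatorOf_levelRate {N : ℕ} {lam xi : ℝ} (f : ℕ → ℝ)
    (hf : f (N + 1) = 0)
    (h0 : lam * (N + 1) * f 1 + xi * ∑ r ∈ Finset.range N, f (r + 1) = lam * N * f 0)
    (hs : ∀ r : ℕ, lam * ((N - r) * f r + (N + r + 2) * f (r + 2)) =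
      (2 * lam * N + xi) * f (r + 1)) :
    Matrix.vecMul (fun k : Fin (N + 1) => f k) (generatorOf (levelRate N lam lam xi)) = 0 := by
  ext k
  have hsplit : Matrix.vecMul (fun k : Fin (N + 1) => f k) (generatorOf (levelRate N lam lam xi)) k
      = ∑ i : Fin (N + 1), f i * levelRate N lam lam xi i k -
        f k * ∑ j, levelRate N lam lam xi k j := by
    rw [generatorOf, Matrix.vecMul_sub, Pi.sub_apply, Matrix.vecMul_diagonal]
    rfl
  rw [hsplit, sum_levelRate]
  simp only [levelRate_apply, mul_add, Finset.sum_add_distrib, mul_ite, mul_zero]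
  rw [sum_fin_ite_eq N (k + 1) fun i => f i * (lam * N) + f i * (lam * i)]
  have hlast : (if (k : ℕ) + 1 ≤ N then
      f (k + 1) * (lam * N) + f (k + 1) * (lam * ((k + 1 : ℕ) : ℝ)) else 0) =
      lam * (N + k + 1) * f (k + 1) := by
    split_ifs with h
    · push_cast
      ring
    · have : (k : ℕ) = N := by omega
      rw [this, hf, mul_zero]
  rw [hlast]
  obtain ⟨k, hk⟩ := k
  rcases k with _ | k
  · have hx : (∑ i : Fin (N + 1), if i = 0 then 0 else f i * xi) =
        xi * ∑ r ∈ Finset.range N, f (r + 1) := by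
      rw [Fin.sum_univ_succ, Finset.mul_sum, ← Fin.sum_univ_eq_sum_range (fun r => xi * f (r + 1))]
      simp [mul_comm]
    simp [hx]
    linear_combination h0
  · have hb := sum_fin_ite_eq N k fun i => f i * (lam * (N - i))
    rw [if_pos (by omega)] at hb
    simp only [Nat.add_right_cancel_iff, eq_comm (a := k), hb]
    simp
    linear_combination hs k

end Ehrenfest

theorem mainTheorem4 (N d : ℕ) (hN : 1 ≤ N) (hd : 1 ≤ d) (lam mu xi : ℝ) (hlam : 0 < lam) (hmu : 0 < mu)
    (hxi : 0 < xi) (hlm : lam = mu) (C : Matrix (Fin d) (Fin d) ℝ)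
    (hC : C ∈ Matrix.rowStochastic ℝ (Fin d)) (hCirr : C.IsIrreducible) :
    ∃ ρ : Fin (N + 1) → ℝ,
      (∀ (l₀ : Fin d) (k : Fin (N + 1)),
        Tendsto (Ehrenfest.levelProb N lam mu xi C l₀ k) atTop (𝓝 (ρ k))) ∧
      (∀ π : Fin (N + 1) × Fin d → ℝ, Ehrenfest.IsStationary N lam mu xi C π →
        ∀ k, ∑ j, π (k, j) = ρ k) ∧
      ρ 0 = 2 / (1 + Ehrenfest.poch (1 + xi / (4 * lam)) N /
        Ehrenfest.poch (1 / 4 * (2 + xi / lam)) N) ∧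
      ∀ r : Fin (N + 1), 1 ≤ (r : ℕ) →
        ρ r = (1 / 4 : ℝ) ^ N * ((2 * N).choose (N - (r : ℕ)) : ℝ) * ((r : ℕ)! : ℝ) *
          (Real.Gamma (1 + xi / (4 * lam)) * Real.Gamma (1 / 2 + xi / (4 * lam)) /
            (Real.Gamma (1 + N + xi / (4 * lam)) * Real.Gamma (1 / 2 + xi / (4 * lam)) +
              Real.Gamma (1 + xi / (4 * lam)) * Real.Gamma (N + 1 / 2 + xi / (4 * lam)))) *
          (Ehrenfest.hyp32 ((r : ℕ) - N) (1 / 2 + (r : ℕ)) (xi / (4 * lam))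
              (1 / 2 - N) ((r : ℕ) + 1 + xi / (4 * lam)) 1 *
              (Real.Gamma (1 + N + xi / (4 * lam)) /
                Real.Gamma (1 + (r : ℕ) + xi / (4 * lam))) +
            Ehrenfest.hyp32 ((r : ℕ) - N) (1 / 2 + (r : ℕ)) (xi / (4 * lam) + 1 / 2)
              (1 / 2 - N) ((r : ℕ) + 1 / 2 + xi / (4 * lam)) 1 *
              (Real.Gamma (1 / 2 + N + xi / (4 * lam)) /
                Real.Gamma (1 / 2 + (r : ℕ) + xi / (4 * lam)))) := by
  open Ehrenfest in
  subst hlm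
  set x := xi / (4 * lam) with hxdef
  have hx : 0 < x := by positivity
  have hxi4 : xi = 4 * lam * x := by rw [hxdef]; field_simp
  set P := poch (1 + x) N with hP
  set R := poch (1 / 2 + x) N with hR
  have hPpos : 0 < P := poch_pos (by positivity) N
  have hRpos : 0 < R := poch_pos (by positivity) N
  have hPR : P + R ≠ 0 := by positivity
  have hq0 : twoSidedProb N x 0 = R / P :=
    eq_div_of_mul_eq hPpos.ne' ((mul_comm _ _).trans (poch_mul_twoSidedProb_zero N hx))
  have hsum := twoSidedProb_sum N hx
  -- The constant is 2 / (1 + q_0) with q_0 = R / P, because q_0 + … + q_N = (1 + q_0) / 2.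
  set f : ℕ → ℝ := fun r => 2 * P / (P + R) * twoSidedProb N x r with hf
  have hbal := vecMul_generatorOf_levelRate (N := N) (lam := lam) (xi := xi) f
    (by simp [hf, twoSidedProb_of_lt])
    (by
      have h0 := twoSidedProb_balance_zero N hx
      simp only [hf, ← Finset.mul_sum]
      rw [hxi4]
      -- Half of the two-sided equation at 0; normalization turns its constant source into the
      -- inflow from positive levels.
      linear_combination 2 * P / (P + R) * (lam / 2 * h0 + 2 * lam * x * hsum))
    (by
      intro r
      have h := twoSidedProb_balance N hx r
      simp only [hf]
      rw [hxi4]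
      linear_combination 2 * P / (P + R) * lam * h)
  have hone : ∑ k : Fin (N + 1), f k = 1 := by
    rw [Fin.sum_univ_eq_sum_range f, Finset.sum_range_succ']
    simp only [hf, ← Finset.mul_sum]
    have hc : 2 * P / (P + R) * (1 + twoSidedProb N x 0) = 2 := by
      rw [hq0]; field_simp
    linear_combination P / (P + R) * hsum + 1 / 2 * hc
  obtain ⟨hlim, hstat⟩ := limit_and_marginal_of_balance hlam.le hlam.le hxi C hC _ hone hbal
  refine ⟨fun k => f k, hlim, hstat, ?_, ?_⟩
  · have he : (1 / 4 : ℝ) * (2 + xi / lam) = 1 / 2 + x := by rw [hxdef]; field_simp; ring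
    rw [he]
    change f 0 = 2 / (1 + P / R)
    simp only [hf, hq0]
    field_simp
    ring
  · rintro ⟨r, hr⟩ hr1
    simp only at hr1 ⊢
    obtain ⟨s, rfl⟩ := Nat.exists_eq_add_of_le' hr1
    obtain ⟨n, rfl⟩ := Nat.exists_eq_add_of_le' (Nat.lt_succ_iff.1 hr)
    have hA := hyp32_eq_twoSidedProb hx n (s + 1)
    have hB := hyp32_eq_reducedProb hx n s
    have hAB := poch_mul_twoSidedProb (n + s) hx (Nat.le_add_left s n)
    rw [add_assoc n s 1, ← hB, ← hA] at hAB
    have g1 : Real.Gamma (1 + (n + (s + 1) : ℕ) + x) = P * Real.Gamma (1 + x) := by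
      rw [add_right_comm, Gamma_add_natCast (by positivity)]
    have g2 : Real.Gamma ((n + (s + 1) : ℕ) + 1 / 2 + x) = R * Real.Gamma (1 / 2 + x) := by
      rw [add_assoc, add_comm, Gamma_add_natCast (by positivity)]
    have g3 : Real.Gamma (1 + (n + (s + 1) : ℕ) + x) / Real.Gamma (1 + (s + 1 : ℕ) + x) =
        poch (1 + (s + 1 : ℕ) + x) n := by
      rw [show (1 : ℝ) + (n + (s + 1) : ℕ) + x = 1 + (s + 1 : ℕ) + x + n by push_cast; ring,
        Gamma_add_natCast (by positivity)]
      exact mul_div_cancel_right₀ _ (Real.Gamma_pos_of_pos (by positivity)).ne'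
    have g4 : Real.Gamma (1 / 2 + (n + (s + 1) : ℕ) + x) / Real.Gamma (1 / 2 + (s + 1 : ℕ) + x) =
        poch (1 / 2 + (s + 1 : ℕ) + x) n := by
      rw [show (1 : ℝ) / 2 + (n + (s + 1) : ℕ) + x = 1 / 2 + (s + 1 : ℕ) + x + n by push_cast; ring,
        Gamma_add_natCast (by positivity)]
      exact mul_div_cancel_right₀ _ (Real.Gamma_pos_of_pos (by positivity)).ne'
    have hG1 := (Real.Gamma_pos_of_pos (show 0 < 1 + x by positivity)).ne'
    have hG2 := (Real.Gamma_pos_of_pos (show 0 < 1 / 2 + x by positivity)).ne'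
    have g5 : Real.Gamma (1 + x) * Real.Gamma (1 / 2 + x) /
        (P * Real.Gamma (1 + x) * Real.Gamma (1 / 2 + x) +
          Real.Gamma (1 + x) * (R * Real.Gamma (1 / 2 + x))) = 1 / (P + R) := by
      field_simp
    rw [g3, g4, g1, g2, g5, Nat.add_sub_cancel,
      show ((s + 1 : ℕ) : ℝ) - (n + (s + 1) : ℕ) = -n by push_cast; ring,
      show (1 / 2 : ℝ) - (n + (s + 1) : ℕ) = 1 / 2 - (n + (s + 1 : ℕ)) by push_cast; ring]
    simp only [hf]
    -- After the rewriting, `hAB` says that the two hypergeometric terms are equal, and `hA`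
    -- identifies the first with `P` times the two-sided probability.
    linear_combination (-2 / (P + R)) * hA + (1 / (P + R)) * hAB
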